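/- \textbf{Lemma (label reduction).} Digraphs are finite, without loops and without parallel arcs (pairs of opposite arcs are allowed); $A(D)$ is the arc set of $D$. An \emph{out-branching} of $D$ is a spanning subgraph of $D$ that is an oriented tree with exactly one vertex of in-degree $0$; its \emph{internal} vertices are those of nonzero out-degree in it. The \emph{internal number} of $D$ is the largest number of internal vertices of an out-branching of $D$ (and $0$ if $D$ has no out-branching). Let $D$ be a digraph, let $U\subseteq V(D)$ be a vertex cover of the underlying undirected graph of $D$ that contains every vertex of in-degree $0$ of $D$, and let $W=V(D)\setminus U$. Let $N^-(W)$ be the set of all in-neighbours of vertices of $W$. Let $B$ be the undirected bipartite graph whose partite sets are the disjoint union $U'=N^-(W)\cup(U\times U)$ and $W$, and whose edges are - $\{x,w\}$ for $x\in U$, $w\in W$ with $(x,w)\in A(D)$, and - $\{xy,w\}$ for $xy\in U\times U$, $w\in W$ with $(x,w)\in A(D)$ and $(w,y)\in A(D)$. A \emph{crown} in an undirected graph $G$ is a pair $(H,C)$ of disjoint sets of vertices, together with a partition $C=C_m\cup C_u$ into two disjoint (possibly empty) sets, such that $H=N(C)$ is exactly the set of neighbours of vertices of $C$, the set $C$ is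 independent, and $G$ has a perfect matching between $C_m$ and $H$. If $B$ has a crown $(H,C=C_m\cup C_u)$ with $C\subseteq W$ and $C_u\neq\emptyset$, then $D$ has an out-branching if and only if $D-C_u$ has one, and the internal number of $D$ equals the internal number of $D-C_u$. -/

import Mathlib

namespace LabelReduction

variable {V : Type*}

/-- The underlying graph of a digraph: forget all orientations and merge parallel edges. -/
abbrev underlying (D : Digraph V) : SimpleGraph V := D.toSimpleGraphInclusive

/-- The vertices of in-degree zero. -/
def sources (D : Digraph V) : Set V := {v | ∀ u, ¬ D.Adj u v}

/-- `N⁻(X)`: the union of the in-neighbourhoods of the vertices in `X`. -/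
def inNeighbors (D : Digraph V) (X : Set V) : Set V := {u | ∃ v ∈ X, D.Adj u v}

/-- The internal vertices: those of nonzero out-degree. -/
def internalVertices (T : Digraph V) : Set V := {v | ∃ w, T.Adj v w}

/-- `T` is an out-tree (with vertex set the whole type): an oriented tree (an orientation of a
tree, so without loops and without pairs of opposite arcs) with exactly one vertex of in-degree
zero. -/
structure IsOutTree (T : Digraph V) : Prop where
  oriented : ∀ u v, T.Adj u v → ¬ T.Adj v u
  isTree : (underlying T).IsTree
  existsUnique_root : ∃! r, r ∈ sources T

/-- An out-branching of `D` is a spanning subgraph of `D` that is an out-tree. -/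
structure IsOutBranching (D T : Digraph V) : Prop where
  le : T ≤ D
  isOutTree : IsOutTree T

/-- The largest number of internal vertices of an out-branching of `D`
(and `0` if `D` has no out-branching). -/
noncomputable def internalNumber (D : Digraph V) : ℕ :=
  sSup {k | ∃ T, IsOutBranching D T ∧ (internalVertices T).ncard = k}

/-- `D - S`: the digraph obtained from `D` by deleting the vertices in `S`. -/
def deleteVertices (D : Digraph V) (S : Set V) : Digraph ↥(Sᶜ) where
  Adj a b := D.Adj a b

/-- The vertex set `U' ∪ W` of the auxiliary graph, where `W` is the complement of `U` and `U'`
is the disjoint union of `N⁻(W)` and `U × U`. -/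
abbrev AuxVertex (D : Digraph V) (U : Set V) : Type _ :=
  (↥(inNeighbors D Uᶜ) ⊕ (↥U × ↥U)) ⊕ ↥(Uᶜ)

/-- The edges of the auxiliary graph, read from `U'` to `W`. -/
def auxRel (D : Digraph V) (U : Set V) : AuxVertex D U → AuxVertex D U → Prop
  | .inl (.inl x), .inr w => x.1 ∈ U ∧ D.Adj x w
  | .inl (.inr (x, y)), .inr w => D.Adj x w ∧ D.Adj w y
  | _, _ => False

/-- The undirected bipartite auxiliary graph `B` with partite sets `U'` and `W`. -/
def auxGraph (D : Digraph V) (U : Set V) : SimpleGraph (AuxVertex D U) :=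
  SimpleGraph.fromRel (auxRel D U)

/-- `(H, C)` with the partition `C = Cm ∪ Cu` is a crown in the graph `G`. -/
structure IsCrown {α : Type*} (G : SimpleGraph α) (H Cm Cu : Set α) : Prop where
  disjoint_parts : Disjoint Cm Cu
  disjoint : Disjoint H (Cm ∪ Cu)
  neighbors : H = {h | ∃ c ∈ Cm ∪ Cu, G.Adj c h}
  independent : G.IsIndepSet (Cm ∪ Cu)
  /-- there is a perfect matching between `Cm` and `H` -/
  matching : ∃ M : ↥Cm ≃ ↥H, ∀ c : ↥Cm, G.Adj (c : α) (M c : α)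

end LabelReduction

/-!
An out-tree on a finite vertex set is the same thing as an arborescence: a root without parent,
exactly one parent for every other vertex, and every vertex reachable from the root
(`IsOutTree.exists_isArborescence`, `IsArborescence.isOutTree`). Both directions rest on counting:
the edges from the `n - 1` non-root vertices to their parents are distinct, and a connected graph
on `n` vertices is a tree exactly when it has `n - 1` edges.

From `D - Cu` to `D`: every vertex of `Cu` lies in the independent set `W` and is not a source, so
it can be attached as a leaf to an in-neighbour outside `Cu`. No internal vertex is lost.

From `D` to `D - Cu`: write `C = Cm ∪ Cu`. The matching of the crown labels the vertices of `Cm`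
bijectively by the elements of `H = N(C)`, that is, by all `x` having an out-neighbour in `C` and
all pairs `(x, y)` joined by a path `x → c → y` with `c ∈ C` (`IsCrownLabelling`,
`exists_isCrownLabelling`). Given an out-branching `T` of `D`, each path `x → c → y` of `T` through
`C` is rerouted through the vertex of `Cm` labelled `(x, y)`, and the remaining vertices of `Cm`
become leaves below the first component of their label (`reroute`). Parents stay unique because `y`
determines its parent `c` in `T`, and reachability is carried along descendants in `T`
(`reroute_served`). If the root `r` of `T` lies in `C`, it still has an in-neighbour `x` in `D`. It
is treated as though `x` were its parent, and the resulting cycle is opened at the vertex of `Cm`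
labelled `(x, y)`, where `y` is the child of `r` above `x`; this vertex becomes the new root
(`IsNewRoot`). An internal vertex outside `C` remains internal, since its leaf with label `x` takes
the place of a lost child, and an internal vertex `c ∈ C` is replaced by the internal vertex with
label `(x, y)` for one of its children `y`; so the number of internal vertices does not drop
(`ncard_internalVertices_le_reroute`).
-/

namespace LabelReduction

/-! ### Out-trees as rooted parent structures -/

/-- `T` is an arborescence with root `r`: the root has no parent, every other vertex has exactly one
parent, and every vertex is reachable from the root. -/
structure IsArborescence {V : Type*} (T : Digraph V) (r : V) : Prop where
  not_adj_root : ∀ u, ¬ T.Adj u r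
  exists_parent : ∀ v, v ≠ r → ∃ u, T.Adj u v
  parent_unique : ∀ u u' v, T.Adj u v → T.Adj u' v → u = u'
  reachable : ∀ v, Relation.ReflTransGen T.Adj r v

lemma underlying_adj_of_adj {V : Type*} {T : Digraph V} (h : ∀ u v, T.Adj u v → ¬ T.Adj v u)
    {u v : V} (huv : T.Adj u v) : (underlying T).Adj u v := by
  refine ⟨?_, Or.inl huv⟩
  rintro rfl
  exact h _ _ huv huv

lemma card_ne_add_one {V : Type*} [Finite V] (r : V) :
    Nat.card {v : V // v ≠ r} + 1 = Nat.card V := by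
  have h := Set.ncard_add_ncard_compl ({r} : Set V)
  rw [Set.ncard_singleton, ← Nat.card_coe_set_eq] at h
  rw [← h, add_comm]
  rfl

/-- The edge of the underlying graph joining a non-root vertex to its chosen parent. -/
def parentEdge {V : Type*} {T : Digraph V} {r : V} (h : ∀ u v, T.Adj u v → ¬ T.Adj v u)
    (par : V → V) (hpar : ∀ v, v ≠ r → T.Adj (par v) v) (v : {v : V // v ≠ r}) :
    (underlying T).edgeSet :=
  ⟨s(par v, v), (SimpleGraph.mem_edgeSet _).2 (underlying_adj_of_adj h (hpar v v.2))⟩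

lemma parentEdge_injective {V : Type*} {T : Digraph V} {r : V}
    (h : ∀ u v, T.Adj u v → ¬ T.Adj v u)
    (par : V → V) (hpar : ∀ v, v ≠ r → T.Adj (par v) v) :
    Function.Injective (parentEdge h par hpar) := by
  rintro ⟨v, hv⟩ ⟨w, hw⟩ hvw
  have h1 : s(par v, v) = s(par w, w) := congrArg Subtype.val hvw
  rcases Sym2.eq_iff.1 h1 with ⟨-, h2⟩ | ⟨h2, h3⟩
  · exact Subtype.ext h2
  · have hv' := hpar v hv
    rw [h2] at hv'
    have hw' := hpar w hw
    rw [← h3] at hw'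
    exact absurd hw' (h _ _ hv')

/-- In a tree with `n` vertices the `n - 1` non-root vertices account for all edges through their
chosen parents, so that no vertex has a second parent. -/
lemma IsOutTree.exists_isArborescence {V : Type*} [Finite V] {T : Digraph V} (hT : IsOutTree T) :
    ∃ r, IsArborescence T r := by
  obtain ⟨r, hr, hru⟩ := hT.existsUnique_root
  have hex : ∀ v, v ≠ r → ∃ u, T.Adj u v := by
    intro v hv
    by_contra hcon
    exact hv (hru v (not_exists.1 hcon))
  have hex' : ∀ v, ∃ u, v ≠ r → T.Adj u v := fun v ↦ by
    by_cases hv : v = r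
    · exact ⟨v, fun h ↦ absurd hv h⟩
    · exact (hex v hv).imp fun _ hu _ ↦ hu
  choose par hpar using hex'
  have hcard := (SimpleGraph.isTree_iff_connected_and_card.1 hT.isTree).2
  have hbij : Function.Bijective (parentEdge hT.oriented par hpar) := by
    rw [Nat.bijective_iff_injective_and_card]
    refine ⟨parentEdge_injective _ _ _, ?_⟩
    have := card_ne_add_one r
    omega
  have hu : ∀ u v, T.Adj u v → u = par v := by
    intro u v huv
    obtain ⟨⟨z, hz⟩, hze⟩ := hbij.2
      ⟨s(u, v), (SimpleGraph.mem_edgeSet _).2 (underlying_adj_of_adj hT.oriented huv)⟩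
    have h1 : s(par z, z) = s(u, v) := congrArg Subtype.val hze
    rcases Sym2.eq_iff.1 h1 with ⟨h2, h3⟩ | ⟨h2, h3⟩
    · rw [← h3, h2]
    · have hz' := hpar z hz
      rw [h2, h3] at hz'
      exact absurd hz' (hT.oriented _ _ huv)
  refine ⟨r, hr, hex, fun u u' v h1 h2 ↦ (hu u v h1).trans (hu u' v h2).symm, fun v ↦ ?_⟩
  have hconn := (SimpleGraph.reachable_iff_reflTransGen r v).1
    (hT.isTree.connected.preconnected r v)
  induction hconn with
  | refl => exact .refl
  | @tail b c _ hbc ih =>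
    rcases hbc with ⟨-, h1 | h1⟩
    · exact ih.tail h1
    · rcases Relation.ReflTransGen.cases_tail ih with h2 | ⟨d, hd, hdb⟩
      · subst h2
        exact absurd h1 (hr c)
      · rwa [hu c b h1, ← hu d b hdb]

lemma IsArborescence.oriented {V : Type*} {T : Digraph V} {r : V} (hT : IsArborescence T r)
    (u v : V) (huv : T.Adj u v) : ¬ T.Adj v u := by
  intro hvu
  -- The pair `u`, `v` would be closed under taking parents, hence not reachable from the root.
  have key : ∀ x, Relation.ReflTransGen T.Adj r x → x ≠ u ∧ x ≠ v := by
    intro x hx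
    induction hx with
    | refl =>
      constructor
      · rintro rfl
        exact hT.not_adj_root _ hvu
      · rintro rfl
        exact hT.not_adj_root _ huv
    | @tail b c _ hbc ih =>
      constructor
      · rintro rfl
        exact ih.2 (hT.parent_unique _ _ _ hbc hvu)
      · rintro rfl
        exact ih.1 (hT.parent_unique _ _ _ hbc huv)
  exact (key u (hT.reachable u)).1 rfl

lemma IsArborescence.isOutTree {V : Type*} [Finite V] {T : Digraph V} {r : V}
    (hT : IsArborescence T r) : IsOutTree T := by
  refine ⟨hT.oriented, ?_, r, hT.not_adj_root, fun v hv ↦ ?_⟩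
  · have hex' : ∀ v, ∃ u, v ≠ r → T.Adj u v := fun v ↦ by
      by_cases hv : v = r
      · exact ⟨v, fun h ↦ absurd hv h⟩
      · exact (hT.exists_parent v hv).imp fun _ hu _ ↦ hu
    choose par hpar using hex'
    have hsurj : Function.Surjective (parentEdge hT.oriented par hpar) := by
      have key : ∀ a b, T.Adj a b → ∃ z : {z : V // z ≠ r}, s(par z, z.1) = s(a, b) := by
        intro a b hab
        have hb : b ≠ r := by
          rintro rfl
          exact hT.not_adj_root _ hab
        exact ⟨⟨b, hb⟩, by rw [hT.parent_unique _ _ _ (hpar b hb) hab]⟩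
      rintro ⟨e, he⟩
      induction e using Sym2.ind with
      | h a b =>
        rcases ((SimpleGraph.mem_edgeSet _).1 he).2 with h | h
        · exact (key a b h).imp fun _ hz ↦ Subtype.ext hz
        · exact (key b a h).imp fun _ hz ↦ Subtype.ext (hz.trans Sym2.eq_swap)
    refine SimpleGraph.isTree_iff_connected_and_card.2 ⟨?_, ?_⟩
    · have hr : ∀ v, (underlying T).Reachable r v := fun v ↦
        (SimpleGraph.reachable_iff_reflTransGen r v).2
          (Relation.ReflTransGen.mono (fun _ _ h ↦ underlying_adj_of_adj hT.oriented h) _ _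
            (hT.reachable v))
      exact { preconnected := fun u v ↦ (hr u).symm.trans (hr v), nonempty := ⟨r⟩ }
    · rw [← Nat.card_eq_of_bijective _ ⟨parentEdge_injective hT.oriented par hpar, hsurj⟩]
      exact card_ne_add_one r
  · by_contra hne
    obtain ⟨u, hu⟩ := hT.exists_parent v hne
    exact hv u hu

/-! ### Comparing internal numbers -/

/-- If every out-branching of `D` can be turned into one of `D'` with at least as many internal
vertices, then the internal number of `D'` is at least that of `D`. -/
lemma internalNumber_le {V V' : Type*} [Finite V'] {D : Digraph V} {D' : Digraph V'}
    (h : ∀ T, IsOutBranching D T → ∃ T', IsOutBranching D' T' ∧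
      (internalVertices T).ncard ≤ (internalVertices T').ncard) :
    internalNumber D ≤ internalNumber D' := by
  refine csSup_le' ?_
  rintro k ⟨T, hT, rfl⟩
  obtain ⟨T', hT', hle⟩ := h T hT
  refine hle.trans (le_csSup ⟨Nat.card V', ?_⟩ ⟨T', hT', rfl⟩)
  rintro k ⟨S, -, rfl⟩
  exact Set.ncard_le_card _

/-! ### Restoring deleted vertices as leaves -/

/-- An out-branching of `D - S` extends to one of `D` by attaching every vertex of `S` as a leaf to
an in-neighbour outside `S`. -/
lemma exists_isOutBranching_of_deleteVertices {V : Type*} [Finite V] {D : Digraph V} {S : Set V}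
    (hS : ∀ s ∈ S, ∃ x, x ∉ S ∧ D.Adj x s) (T : Digraph ↥(Sᶜ))
    (hT : IsOutBranching (deleteVertices D S) T) :
    ∃ T', IsOutBranching D T' ∧
      (internalVertices T).ncard ≤ (internalVertices T').ncard := by
  obtain ⟨r, hr⟩ := hT.isOutTree.exists_isArborescence
  choose! p hpS hpD using hS
  let T' : Digraph V :=
    ⟨fun u v ↦ (∃ (hu : u ∈ Sᶜ) (hv : v ∈ Sᶜ), T.Adj ⟨u, hu⟩ ⟨v, hv⟩) ∨ (v ∈ S ∧ u = p v)⟩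
  have hlift : ∀ x, Relation.ReflTransGen T.Adj r x →
      Relation.ReflTransGen T'.Adj (r : V) (x : V) := by
    intro x hx
    induction hx with
    | refl => exact .refl
    | tail _ hbc ih => exact ih.tail (Or.inl ⟨_, _, hbc⟩)
  have harb : IsArborescence T' (r : V) := by
    refine ⟨?_, ?_, ?_, ?_⟩
    · rintro u (⟨hu, hv, h⟩ | ⟨h, -⟩)
      · exact hr.not_adj_root _ h
      · exact r.2 h
    · intro v hv
      by_cases hvS : v ∈ S
      · exact ⟨p v, Or.inr ⟨hvS, rfl⟩⟩
      · obtain ⟨u, hu⟩ := hr.exists_parent ⟨v, hvS⟩ fun h ↦ hv (congrArg Subtype.val h)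
        exact ⟨u, Or.inl ⟨u.2, hvS, hu⟩⟩
    · rintro u u' v (⟨hu, hv, h⟩ | ⟨hv, rfl⟩) (⟨hu', hv', h'⟩ | ⟨hv', rfl⟩)
      · exact congrArg Subtype.val (hr.parent_unique _ _ _ h h')
      · exact absurd hv' hv
      · exact absurd hv hv'
      · rfl
    · intro v
      by_cases hvS : v ∈ S
      · exact (hlift ⟨p v, hpS v hvS⟩ (hr.reachable _)).tail (Or.inr ⟨hvS, rfl⟩)
      · exact hlift ⟨v, hvS⟩ (hr.reachable _)
  refine ⟨T', ⟨?_, harb.isOutTree⟩, ?_⟩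
  · rintro u v (⟨hu, hv, h⟩ | ⟨hv, rfl⟩)
    · exact hT.le h
    · exact hpD v hv
  · rw [← Set.ncard_image_of_injective _ Subtype.val_injective]
    refine Set.ncard_le_ncard ?_
    rintro _ ⟨x, ⟨y, hxy⟩, rfl⟩
    exact ⟨y, Or.inl ⟨x.2, y.2, hxy⟩⟩

/-! ### Labels of a crown -/

/-- The matching of a crown of the auxiliary graph, read as a labelling of `Cm`. The vertex `w` has
a parent `p w` and an optional child `q w`: it is matched with `p w` if `q w = none` and with the
pair `(p w, y)` if `q w = some y`. The labels that occur are exactly those of the paths through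
`Cm ∪ Cu`. -/
structure IsCrownLabelling {V : Type*} (D : Digraph V) (Cm Cu : Set V) (p : V → V)
    (q : V → Option V) : Prop where
  disjoint : Disjoint Cm Cu
  not_adj : ∀ u ∈ Cm ∪ Cu, ∀ v ∈ Cm ∪ Cu, ¬ D.Adj u v
  exists_adj : ∀ c ∈ Cm ∪ Cu, ∃ x, D.Adj x c
  adj_parent : ∀ w ∈ Cm, D.Adj (p w) w
  adj_child : ∀ w ∈ Cm, ∀ y, q w = some y → D.Adj w y
  injective : ∀ w ∈ Cm, ∀ w' ∈ Cm, p w = p w' → q w = q w' → w = w'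
  exists_none : ∀ c ∈ Cm ∪ Cu, ∀ x, D.Adj x c → ∃ w ∈ Cm, p w = x ∧ q w = none
  exists_some : ∀ c ∈ Cm ∪ Cu, ∀ x y, D.Adj x c → D.Adj c y → ∃ w ∈ Cm, p w = x ∧ q w = some y

/-- The arcs of the rerouted out-branching, where `g` gives the parents of the vertices of
`Cm ∪ Cu` in `T`. Arcs of `T` that avoid `Cm ∪ Cu` are kept, each vertex of `Cm` hangs from the
first component of its label, and a path `x → c → y` of `T` with `c ∈ Cm ∪ Cu` is replaced by the
path through the vertex of `Cm` with label `(x, y)`. -/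
def reroute {V : Type*} (T : Digraph V) (Cm Cu : Set V) (p : V → V) (q : V → Option V) (g : V → V)
    (r' : V) : Digraph V where
  Adj u v := (u ∉ Cm ∪ Cu ∧ v ∉ Cm ∪ Cu ∧ T.Adj u v) ∨ (v ∈ Cm ∧ v ≠ r' ∧ u = p v) ∨
    (u ∈ Cm ∧ q u = some v ∧ ∃ c ∈ Cm ∪ Cu, g c = p u ∧ T.Adj c v)

/-- The vertex `r'` may serve as the new root. If the root `r` of `T` lies outside the crown, then
`r' = r`. Otherwise `g r` is an in-neighbour of `r` in `D`, hence a descendant of some child `y` of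
`r`, and `r'` is the vertex of `Cm` with label `(g r, y)`. -/
def IsNewRoot {V : Type*} (T : Digraph V) (Cm Cu : Set V) (p : V → V) (q : V → Option V) (g : V → V)
    (r r' : V) : Prop :=
  (r ∉ Cm ∪ Cu ∧ r' = r) ∨ (r ∈ Cm ∪ Cu ∧ r' ∈ Cm ∧ ∃ y, q r' = some y ∧ p r' = g r ∧
    T.Adj r y ∧ Relation.ReflTransGen T.Adj y (g r))

lemma exists_isNewRoot {V : Type*} {D T : Digraph V} {Cm Cu : Set V} {p : V → V} {q : V → Option V}
    {g : V → V} {r : V} (hL : IsCrownLabelling D Cm Cu p q) (hle : T ≤ D)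
    (hr : IsArborescence T r) (hg : ∀ c ∈ Cm ∪ Cu, D.Adj (g c) c) :
    ∃ r', IsNewRoot T Cm Cu p q g r r' := by
  by_cases hrC : r ∈ Cm ∪ Cu
  · rcases Relation.ReflTransGen.cases_head (hr.reachable (g r)) with h | ⟨y, hry, hy⟩
    · exact absurd (hg r hrC) (h ▸ hL.not_adj r hrC r hrC)
    · obtain ⟨w, hw, hpw, hqw⟩ := hL.exists_some r hrC _ _ (hg r hrC) (hle hry)
      exact ⟨w, Or.inr ⟨hrC, hw, y, hqw, hpw, hry, hy⟩⟩
  · exact ⟨r, Or.inl ⟨hrC, rfl⟩⟩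

section Reroute

variable {V : Type*} {D T : Digraph V} {Cm Cu : Set V} {p : V → V} {q : V → Option V} {g : V → V}
  {r r' : V}

lemma reroute_le (hL : IsCrownLabelling D Cm Cu p q) (hle : T ≤ D) :
    reroute T Cm Cu p q g r' ≤ D := by
  rintro u v (⟨-, -, h⟩ | ⟨hv, -, rfl⟩ | ⟨hu, hq, -⟩)
  · exact hle h
  · exact hL.adj_parent v hv
  · exact hL.adj_child u hu v hq

lemma reroute_avoids (hL : IsCrownLabelling D Cm Cu p q) {u v : V}
    (h : (reroute T Cm Cu p q g r').Adj u v) : u ∉ Cu ∧ v ∉ Cu := by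
  have hd : ∀ x ∈ Cm, x ∉ Cu := fun _ hx ↦ Set.disjoint_left.1 hL.disjoint hx
  rcases h with ⟨hu, hv, -⟩ | ⟨hv, -, rfl⟩ | ⟨hu, hq, -⟩
  · exact ⟨fun h ↦ hu (Or.inr h), fun h ↦ hv (Or.inr h)⟩
  · exact ⟨fun h ↦ hL.not_adj _ (Or.inr h) v (Or.inl hv) (hL.adj_parent v hv), hd v hv⟩
  · exact ⟨hd u hu, fun h ↦ hL.not_adj u (Or.inl hu) v (Or.inr h) (hL.adj_child u hu v hq)⟩

lemma reroute_not_adj_root (hL : IsCrownLabelling D Cm Cu p q)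
    (hr : IsArborescence T r) (hr' : IsNewRoot T Cm Cu p q g r r') (u : V) :
    ¬ (reroute T Cm Cu p q g r').Adj u r' := by
  rintro (⟨-, hv, h⟩ | ⟨-, h, -⟩ | ⟨hu, hq, c, -, -, h⟩)
  · rcases hr' with ⟨-, rfl⟩ | ⟨-, hm, -⟩
    · exact hr.not_adj_root u h
    · exact hv (Or.inl hm)
  · exact h rfl
  · rcases hr' with ⟨-, rfl⟩ | ⟨-, hm, -⟩
    · exact hr.not_adj_root c h
    · exact hL.not_adj u (Or.inl hu) r' (Or.inl hm) (hL.adj_child u hu r' hq)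

lemma reroute_exists_parent (hL : IsCrownLabelling D Cm Cu p q) (hle : T ≤ D)
    (hr : IsArborescence T r) (hr' : IsNewRoot T Cm Cu p q g r r')
    (hg : ∀ c ∈ Cm ∪ Cu, D.Adj (g c) c) (v : V) (hvu : v ∉ Cu) (hv : v ≠ r') :
    ∃ u, (reroute T Cm Cu p q g r').Adj u v := by
  by_cases hvm : v ∈ Cm
  · exact ⟨p v, Or.inr (Or.inl ⟨hvm, hv, rfl⟩)⟩
  · have hvC : v ∉ Cm ∪ Cu := fun h ↦ h.elim hvm hvu
    have hvr : v ≠ r := by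
      rintro rfl
      rcases hr' with ⟨-, rfl⟩ | ⟨h, -⟩
      · exact hv rfl
      · exact hvC h
    obtain ⟨u, hu⟩ := hr.exists_parent v hvr
    by_cases huC : u ∈ Cm ∪ Cu
    · obtain ⟨w, hw, hpw, hqw⟩ := hL.exists_some u huC _ _ (hg u huC) (hle hu)
      exact ⟨w, Or.inr (Or.inr ⟨hw, hqw, u, huC, hpw.symm, hu⟩)⟩
    · exact ⟨u, Or.inl ⟨huC, hvC, hu⟩⟩

lemma reroute_parent_unique (hL : IsCrownLabelling D Cm Cu p q)
    (hr : IsArborescence T r) (u u' v : V) (h : (reroute T Cm Cu p q g r').Adj u v)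
    (h' : (reroute T Cm Cu p q g r').Adj u' v) : u = u' := by
  have hout : ∀ w ∈ Cm, q w = some v → v ∉ Cm := fun w hw hq hv ↦
    hL.not_adj w (Or.inl hw) v (Or.inl hv) (hL.adj_child w hw v hq)
  rcases h with ⟨hu, hv, h⟩ | ⟨hv, -, rfl⟩ | ⟨hu, hq, c, hc, hgc, hcv⟩ <;>
  rcases h' with ⟨hu', hv', h'⟩ | ⟨hv', -, rfl⟩ | ⟨hu', hq', c', hc', hgc', hcv'⟩
  · exact hr.parent_unique _ _ _ h h'
  · exact absurd (Or.inl hv') hv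
  · exact absurd hc' (hr.parent_unique _ _ _ h hcv' ▸ hu)
  · exact absurd (Or.inl hv) hv'
  · rfl
  · exact absurd hv (hout u' hu' hq')
  · exact absurd hc (hr.parent_unique _ _ _ h' hcv ▸ hu')
  · exact absurd hv' (hout u hu hq)
  · obtain rfl := hr.parent_unique _ _ _ hcv hcv'
    exact hL.injective u hu u' hu' (hgc.symm.trans hgc') (hq.trans hq'.symm)

/-- A vertex `v` of `T` counts as served by the rerouted digraph `R` if `R` reaches `v` itself when
`v` is outside the crown, and the parent `g v` when `v` is in the crown. This property passes from
a vertex to all its descendants in `T`. -/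
lemma reroute_served (hL : IsCrownLabelling D Cm Cu p q) (hle : T ≤ D)
    (hr : IsArborescence T r) (hg : ∀ c ∈ Cm ∪ Cu, D.Adj (g c) c)
    (hgT : ∀ c ∈ Cm ∪ Cu, c ≠ r → T.Adj (g c) c) {s v : V}
    (hs : (s ∉ Cm ∪ Cu → Relation.ReflTransGen (reroute T Cm Cu p q g r').Adj r' s) ∧
      (s ∈ Cm ∪ Cu → Relation.ReflTransGen (reroute T Cm Cu p q g r').Adj r' (g s)))
    (hsv : Relation.ReflTransGen T.Adj s v) :
    (v ∉ Cm ∪ Cu → Relation.ReflTransGen (reroute T Cm Cu p q g r').Adj r' v) ∧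
      (v ∈ Cm ∪ Cu → Relation.ReflTransGen (reroute T Cm Cu p q g r').Adj r' (g v)) := by
  induction hsv with
  | refl => exact hs
  | @tail b c _ hbc ih =>
    refine ⟨fun hc ↦ ?_, fun hc ↦ ?_⟩
    · by_cases hb : b ∈ Cm ∪ Cu
      · obtain ⟨w, hw, hpw, hqw⟩ := hL.exists_some b hb _ _ (hg b hb) (hle hbc)
        have hwc : (reroute T Cm Cu p q g r').Adj w c :=
          Or.inr (Or.inr ⟨hw, hqw, b, hb, hpw.symm, hbc⟩)
        by_cases hwr : w = r'
        · subst hwr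
          exact .single hwc
        · exact ((ih.2 hb).tail (Or.inr (Or.inl ⟨hw, hwr, hpw.symm⟩))).tail hwc
      · exact (ih.1 hb).tail (Or.inl ⟨hb, hc, hbc⟩)
    · have hcr : c ≠ r := by
        rintro rfl
        exact hr.not_adj_root _ hbc
      have hgc : g c = b := hr.parent_unique _ _ _ (hgT c hc hcr) hbc
      rw [hgc]
      exact ih.1 fun hb ↦ hL.not_adj b hb c hc (hle hbc)

lemma reroute_reachable (hL : IsCrownLabelling D Cm Cu p q) (hle : T ≤ D)
    (hr : IsArborescence T r) (hr' : IsNewRoot T Cm Cu p q g r r')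
    (hg : ∀ c ∈ Cm ∪ Cu, D.Adj (g c) c)
    (hgT : ∀ c ∈ Cm ∪ Cu, c ≠ r → T.Adj (g c) c) (v : V) (hvu : v ∉ Cu) :
    Relation.ReflTransGen (reroute T Cm Cu p q g r').Adj r' v := by
  have hserved : (r ∉ Cm ∪ Cu → Relation.ReflTransGen (reroute T Cm Cu p q g r').Adj r' r) ∧
      (r ∈ Cm ∪ Cu → Relation.ReflTransGen (reroute T Cm Cu p q g r').Adj r' (g r)) := by
    rcases hr' with ⟨hrC, rfl⟩ | ⟨hrC, hm, y, hqy, hpy, hry, hyg⟩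
    · exact ⟨fun _ ↦ .refl, fun h ↦ absurd h hrC⟩
    · refine ⟨fun h ↦ absurd hrC h, fun _ ↦ ?_⟩
      -- The child `y` of `r` is reached directly from `r'`, and `g r` is a descendant of `y`.
      have hyC : y ∉ Cm ∪ Cu := fun h ↦ hL.not_adj r hrC y h (hle hry)
      have hr'y : (reroute T Cm Cu p q g r').Adj r' y :=
        Or.inr (Or.inr ⟨hm, hqy, r, hrC, hpy.symm, hry⟩)
      exact (reroute_served hL hle hr hg hgT ⟨fun _ ↦ .single hr'y, fun h ↦ absurd h hyC⟩ hyg).1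
        fun h ↦ hL.not_adj _ h r hrC (hg r hrC)
  have hall : ∀ v ∉ Cm ∪ Cu, Relation.ReflTransGen (reroute T Cm Cu p q g r').Adj r' v :=
    fun v hv ↦ (reroute_served hL hle hr hg hgT hserved (hr.reachable v)).1 hv
  by_cases hvm : v ∈ Cm
  · by_cases hvr : v = r'
    · rw [hvr]
    · exact (hall (p v) fun h ↦ hL.not_adj _ h v (Or.inl hvm) (hL.adj_parent v hvm)).tail
        (Or.inr (Or.inl ⟨hvm, hvr, rfl⟩))
  · exact hall v fun h ↦ h.elim hvm hvu

/-- A vertex outside the crown that is internal in `T` stays internal: a child in the crown is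
replaced by the vertex of `Cm` labelled by the vertex alone. An internal crown vertex `c` with child
`y` is charged to the vertex of `Cm` with label `(g c, y)`, which determines `c` as the parent of
`y`. -/
lemma ncard_internalVertices_le_reroute [Finite V] (hL : IsCrownLabelling D Cm Cu p q)
    (hle : T ≤ D) (hr : IsArborescence T r) (hr' : IsNewRoot T Cm Cu p q g r r')
    (hg : ∀ c ∈ Cm ∪ Cu, D.Adj (g c) c) :
    (internalVertices T).ncard ≤ (internalVertices (reroute T Cm Cu p q g r')).ncard := by
  have hf : ∀ v ∈ internalVertices T, ∃ w, (v ∉ Cm ∪ Cu → w = v) ∧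
      (v ∈ Cm ∪ Cu → w ∈ Cm ∧ ∃ y, p w = g v ∧ q w = some y ∧ T.Adj v y) := by
    rintro v ⟨y, hvy⟩
    by_cases hv : v ∈ Cm ∪ Cu
    · obtain ⟨w, hw, hpw, hqw⟩ := hL.exists_some v hv _ _ (hg v hv) (hle hvy)
      exact ⟨w, fun h ↦ absurd hv h, fun _ ↦ ⟨hw, y, hpw, hqw, hvy⟩⟩
    · exact ⟨v, fun _ ↦ rfl, fun h ↦ absurd h hv⟩
  choose! f hf1 hf2 using hf
  refine Set.ncard_le_ncard_of_injOn f ?_ ?_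
  · rintro v hv
    by_cases hvC : v ∈ Cm ∪ Cu
    · obtain ⟨hw, y, hpw, hqw, hvy⟩ := hf2 v hv hvC
      exact ⟨y, Or.inr (Or.inr ⟨hw, hqw, v, hvC, hpw.symm, hvy⟩)⟩
    · rw [hf1 v hv hvC]
      obtain ⟨y, hvy⟩ := hv
      by_cases hy : y ∈ Cm ∪ Cu
      · obtain ⟨w, hw, hpw, hqw⟩ := hL.exists_none y hy _ (hle hvy)
        refine ⟨w, Or.inr (Or.inl ⟨hw, ?_, hpw.symm⟩)⟩
        -- The new root is not in `Cm` or has a label of the form `(x, y)`.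
        rintro rfl
        rcases hr' with ⟨h, rfl⟩ | ⟨-, -, z, hz, -⟩
        · exact h (Or.inl hw)
        · simp [hz] at hqw
      · exact ⟨y, Or.inl ⟨hvC, hy, hvy⟩⟩
  · intro v hv v' hv' hvv'
    by_cases hvC : v ∈ Cm ∪ Cu <;> by_cases hvC' : v' ∈ Cm ∪ Cu
    · obtain ⟨hw, y, hpw, hqw, hvy⟩ := hf2 v hv hvC
      obtain ⟨hw', y', hpw', hqw', hvy'⟩ := hf2 v' hv' hvC'
      rw [hvv', hqw'] at hqw
      rw [Option.some.inj hqw] at hvy'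
      exact hr.parent_unique _ _ _ hvy hvy'
    · have := (hf2 v hv hvC).1
      rw [hvv', hf1 v' hv' hvC'] at this
      exact absurd (Or.inl this) hvC'
    · have := (hf2 v' hv' hvC').1
      rw [← hvv', hf1 v hv hvC] at this
      exact absurd (Or.inl this) hvC
    · rwa [hf1 v hv hvC, hf1 v' hv' hvC'] at hvv'

/-- Rerouting along the labels turns an out-branching of `D` into one of `D - Cu` without losing
internal vertices. -/
lemma IsCrownLabelling.exists_isOutBranching [Finite V] (hL : IsCrownLabelling D Cm Cu p q)
    (hT : IsOutBranching D T) :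
    ∃ T', IsOutBranching (deleteVertices D Cu) T' ∧
      (internalVertices T).ncard ≤ (internalVertices T').ncard := by
  obtain ⟨r, hr⟩ := hT.isOutTree.exists_isArborescence
  have hex : ∀ c ∈ Cm ∪ Cu, ∃ x, D.Adj x c ∧ (c ≠ r → T.Adj x c) := by
    intro c hc
    by_cases hcr : c = r
    · exact (hL.exists_adj c hc).imp fun _ hx ↦ ⟨hx, fun h ↦ absurd hcr h⟩
    · exact (hr.exists_parent c hcr).imp fun _ hx ↦ ⟨hT.le hx, fun _ ↦ hx⟩
  choose! g hg hgT using hex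
  obtain ⟨r', hr'⟩ := exists_isNewRoot hL hT.le hr hg
  have hr'u : r' ∈ Cuᶜ := by
    rcases hr' with ⟨h, rfl⟩ | ⟨-, hm, -⟩
    · exact fun h' ↦ h (Or.inr h')
    · exact Set.disjoint_left.1 hL.disjoint hm
  set R := reroute T Cm Cu p q g r'
  have hlift : ∀ x, Relation.ReflTransGen R.Adj r' x → ∀ hx : x ∈ Cuᶜ,
      Relation.ReflTransGen (deleteVertices R Cu).Adj ⟨r', hr'u⟩ ⟨x, hx⟩ := by
    intro x h
    induction h with
    | refl => exact fun _ ↦ .refl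
    | tail _ hbc ih => exact fun hx ↦ (ih (reroute_avoids hL hbc).1).tail hbc
  have harb : IsArborescence (deleteVertices R Cu) ⟨r', hr'u⟩ := by
    refine ⟨fun u ↦ reroute_not_adj_root hL hr hr' u, fun v hv ↦ ?_, fun u u' v h h' ↦ ?_,
      fun v ↦ hlift v (reroute_reachable hL hT.le hr hr' hg hgT v v.2) v.2⟩
    · obtain ⟨u, hu⟩ := reroute_exists_parent hL hT.le hr hr' hg v v.2
        fun h ↦ hv (Subtype.ext h)
      exact ⟨⟨u, (reroute_avoids hL hu).1⟩, hu⟩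
    · exact Subtype.ext (reroute_parent_unique hL hr u u' v h h')
  refine ⟨deleteVertices R Cu, ⟨?_, harb.isOutTree⟩, ?_⟩
  · intro u v h
    exact reroute_le hL hT.le h
  · refine (ncard_internalVertices_le_reroute hL hT.le hr hr' hg).trans ?_
    rw [← Set.ncard_image_of_injective (internalVertices (deleteVertices R Cu))
      Subtype.val_injective]
    refine Set.ncard_le_ncard ?_
    rintro v ⟨w, hw⟩
    exact ⟨⟨v, (reroute_avoids hL hw).1⟩, ⟨⟨w, (reroute_avoids hL hw).2⟩, hw⟩, rfl⟩

end Reroute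

/-! ### The labelling given by a crown of the auxiliary graph -/

/-- The label of a vertex of `U'`: `x ∈ N⁻(W)` has label `(x, none)` and `(x, y) ∈ U × U` has label
`(x, some y)`. The value on `W` plays no role. -/
def auxLabel {V : Type*} (D : Digraph V) (U : Set V) : AuxVertex D U → V × Option V
  | .inl (.inl x) => (x, none)
  | .inl (.inr (x, y)) => (x, some (y : V))
  | .inr w => (w, none)

lemma auxLabel_inl_injective {V : Type*} (D : Digraph V) (U : Set V) :
    Function.Injective fun a ↦ auxLabel D U (.inl a) := by
  rintro (⟨x, hx⟩ | ⟨⟨x, hx⟩, ⟨y, hy⟩⟩) (⟨x', hx'⟩ | ⟨⟨x', hx'⟩, ⟨y', hy'⟩⟩) h <;>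
    simp_all [auxLabel]

lemma not_auxGraph_adj_inr_inr {V : Type*} {D : Digraph V} {U : Set V} {w w' : ↥(Uᶜ)} :
    ¬ (auxGraph D U).Adj (.inr w) (.inr w') := by
  rintro ⟨-, h | h⟩ <;> exact h

lemma auxGraph_adj_inr_inl {V : Type*} {D : Digraph V} {U : Set V} {w : ↥(Uᶜ)}
    {a : ↥(inNeighbors D Uᶜ) ⊕ (↥U × ↥U)} :
    (auxGraph D U).Adj (.inr w) (.inl a) ↔ auxRel D U (.inl a) (.inr w) := by
  refine ⟨?_, fun h ↦ ⟨by simp, Or.inr h⟩⟩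
  rintro ⟨-, h | h⟩
  · exact h.elim
  · exact h

lemma adj_of_auxGraph_adj {V : Type*} {D : Digraph V} {U : Set V} {w : ↥(Uᶜ)} {h : AuxVertex D U}
    (hwh : (auxGraph D U).Adj (.inr w) h) :
    D.Adj (auxLabel D U h).1 w ∧ ∀ y, (auxLabel D U h).2 = some y → D.Adj w y := by
  rcases h with (x | ⟨x, y⟩) | w'
  · exact ⟨(auxGraph_adj_inr_inl.1 hwh).2, fun y hy ↦ by simp [auxLabel] at hy⟩
  · obtain ⟨h1, h2⟩ := auxGraph_adj_inr_inl.1 hwh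
    refine ⟨h1, fun z hz ↦ ?_⟩
    obtain rfl : (y : V) = z := Option.some.inj hz
    exact h2
  · exact absurd hwh not_auxGraph_adj_inr_inr

lemma exists_isCrownLabelling {V : Type*} {D : Digraph V} (hloop : ∀ v, ¬ D.Adj v v) {U : Set V}
    (hcover : (underlying D).IsVertexCover U) (hsources : sources D ⊆ U)
    {H : Set (AuxVertex D U)} {Cm Cu : Set ↥(Uᶜ)}
    (hcrown : IsCrown (auxGraph D U) H (Sum.inr '' Cm) (Sum.inr '' Cu)) :
    ∃ p q, IsCrownLabelling D (Subtype.val '' Cm) (Subtype.val '' Cu) p q := by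
  have hcov : ∀ u v, D.Adj u v → u ∈ U ∨ v ∈ U := fun u v h ↦
    hcover ⟨fun he ↦ hloop v (he ▸ h), Or.inl h⟩
  have hC : ∀ c ∈ Subtype.val '' Cm ∪ Subtype.val '' Cu, ∃ w : ↥(Uᶜ), (w : V) = c ∧
      (Sum.inr w : AuxVertex D U) ∈ Sum.inr '' Cm ∪ Sum.inr '' Cu := by
    rintro _ (⟨w, hw, rfl⟩ | ⟨w, hw, rfl⟩)
    · exact ⟨w, rfl, Or.inl ⟨w, hw, rfl⟩⟩
    · exact ⟨w, rfl, Or.inr ⟨w, hw, rfl⟩⟩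
  obtain ⟨M, hM⟩ := hcrown.matching
  have hlab : ∀ v ∈ Subtype.val '' Cm, ∃ z : V × Option V, ∃ (w : ↥(Uᶜ)) (hw : w ∈ Cm), (w : V) = v ∧
      z = auxLabel D U (M ⟨.inr w, Set.mem_image_of_mem _ hw⟩) := by
    rintro _ ⟨w, hw, rfl⟩
    exact ⟨_, w, hw, rfl, rfl⟩
  choose! z hz using hlab
  -- Every label met at a crown vertex is the label of a matched vertex.
  have hsurj : ∀ (w : ↥(Uᶜ)) (h : AuxVertex D U),
      (Sum.inr w : AuxVertex D U) ∈ Sum.inr '' Cm ∪ Sum.inr '' Cu → (auxGraph D U).Adj (.inr w) h →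
      ∃ v ∈ Subtype.val '' Cm, z v = auxLabel D U h := by
    intro w h hw hwh
    have hH : h ∈ H := by
      rw [hcrown.neighbors]
      exact ⟨_, hw, hwh⟩
    obtain ⟨⟨_, u, hu, rfl⟩, hMu⟩ := M.surjective ⟨h, hH⟩
    refine ⟨u, ⟨u, hu, rfl⟩, ?_⟩
    obtain ⟨u', hu', huu', hzu⟩ := hz u ⟨u, hu, rfl⟩
    obtain rfl := Subtype.ext huu'
    rw [hzu, hMu]
  refine ⟨fun v ↦ (z v).1, fun v ↦ (z v).2, ?_, ?_, ?_, ?_, ?_, ?_, ?_, ?_⟩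
  · exact (Set.disjoint_image_iff Subtype.val_injective).2
      ((Set.disjoint_image_iff Sum.inr_injective).1 hcrown.disjoint_parts)
  · intro u hu v hv huv
    obtain ⟨u, rfl, -⟩ := hC u hu
    obtain ⟨v, rfl, -⟩ := hC v hv
    exact (hcov _ _ huv).elim u.2 v.2
  · intro c hc
    obtain ⟨w, rfl, -⟩ := hC c hc
    by_contra hcon
    exact w.2 (hsources (not_exists.1 hcon))
  · intro v hv
    obtain ⟨w, hw, rfl, hzw⟩ := hz v hv
    simp only [hzw]
    exact (adj_of_auxGraph_adj (hM ⟨.inr w, Set.mem_image_of_mem _ hw⟩)).1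
  · intro v hv y hy
    obtain ⟨w, hw, rfl, hzw⟩ := hz v hv
    simp only [hzw] at hy
    exact (adj_of_auxGraph_adj (hM ⟨.inr w, Set.mem_image_of_mem _ hw⟩)).2 y hy
  · intro v hv v' hv' h1 h2
    obtain ⟨w, hw, rfl, hzw⟩ := hz v hv
    obtain ⟨w', hw', rfl, hzw'⟩ := hz v' hv'
    have h := Prod.ext h1 h2
    rw [hzw, hzw'] at h
    have hadj := hM ⟨.inr w, Set.mem_image_of_mem _ hw⟩
    have hadj' := hM ⟨.inr w', Set.mem_image_of_mem _ hw'⟩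
    have hMM : M ⟨.inr w, Set.mem_image_of_mem _ hw⟩ = M ⟨.inr w', Set.mem_image_of_mem _ hw'⟩ := by
      apply Subtype.ext
      generalize ((M ⟨.inr w, Set.mem_image_of_mem _ hw⟩ : H) : AuxVertex D U) = a at *
      generalize ((M ⟨.inr w', Set.mem_image_of_mem _ hw'⟩ : H) : AuxVertex D U) = a' at *
      rcases a with a | a
      · rcases a' with a' | a'
        · exact congrArg _ (auxLabel_inl_injective D U h)
        · exact absurd hadj' not_auxGraph_adj_inr_inr
      · exact absurd hadj not_auxGraph_adj_inr_inr
    have := congrArg Subtype.val (M.injective hMM)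
    exact congrArg Subtype.val (Sum.inr_injective this)
  · intro c hc x hxc
    obtain ⟨w, rfl, hw⟩ := hC c hc
    have hx : x ∈ U := (hcov _ _ hxc).resolve_right w.2
    obtain ⟨v, hv, hzv⟩ := hsurj w (.inl (.inl ⟨x, w, w.2, hxc⟩)) hw
      (auxGraph_adj_inr_inl.2 ⟨hx, hxc⟩)
    exact ⟨v, hv, congrArg Prod.fst hzv, congrArg Prod.snd hzv⟩
  · intro c hc x y hxc hcy
    obtain ⟨w, rfl, hw⟩ := hC c hc
    have hx : x ∈ U := (hcov _ _ hxc).resolve_right w.2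
    have hy : y ∈ U := (hcov _ _ hcy).resolve_left w.2
    obtain ⟨v, hv, hzv⟩ := hsurj w (.inl (.inr (⟨x, hx⟩, ⟨y, hy⟩))) hw
      (auxGraph_adj_inr_inl.2 ⟨hxc, hcy⟩)
    exact ⟨v, hv, congrArg Prod.fst hzv, congrArg Prod.snd hzv⟩

end LabelReduction

theorem mainTheorem3 {V : Type*} [Finite V] (D : Digraph V)
    (hloop : ∀ v, ¬ D.Adj v v)
    (U : Set V)
    (hcover : (LabelReduction.underlying D).IsVertexCover U)
    (hsources : LabelReduction.sources D ⊆ U)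
    (H : Set (LabelReduction.AuxVertex D U))
    (Cm Cu : Set ↥(Uᶜ))
    (hcrown : LabelReduction.IsCrown (LabelReduction.auxGraph D U) H
      (Sum.inr '' Cm) (Sum.inr '' Cu))
    (hCu : Cu.Nonempty) :
    ((∃ T, LabelReduction.IsOutBranching D T) ↔
      ∃ T, LabelReduction.IsOutBranching
        (LabelReduction.deleteVertices D (Subtype.val '' Cu)) T) ∧
    LabelReduction.internalNumber D =
      LabelReduction.internalNumber
        (LabelReduction.deleteVertices D (Subtype.val '' Cu)) := by
  obtain ⟨p, q, hL⟩ :=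
    LabelReduction.exists_isCrownLabelling hloop hcover hsources hcrown
  have hdel := fun T hT ↦ LabelReduction.IsCrownLabelling.exists_isOutBranching (T := T) hL hT
  have hadd := LabelReduction.exists_isOutBranching_of_deleteVertices (D := D)
    (S := Subtype.val '' Cu) fun s hs ↦ (hL.exists_adj s (Or.inr hs)).imp fun x hx ↦
      ⟨fun h ↦ hL.not_adj x (Or.inr h) s (Or.inr hs) hx, hx⟩
  refine ⟨⟨?_, ?_⟩, le_antisymm (LabelReduction.internalNumber_le hdel)
    (LabelReduction.internalNumber_le hadd)⟩
  · rintro ⟨T, hT⟩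
    exact (hdel T hT).imp fun _ h ↦ h.1
  · rintro ⟨T, hT⟩
    exact (hadd T hT).imp fun _ h ↦ h.1
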